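/- **Setting.** Let $P<N$, $c\in\mathbb{R}^N$, let $A\in\mathbb{R}^{P\times N}$ have full row rank, and let $b_0,b_1,\dots\in\mathbb{R}^P$. For $i=1,\dots,I$ let $K_i\subset\mathbb{R}^{q_i}$ be a proper cone (closed, convex, with nonempty interior, containing no line) and $g_i:\mathbb{R}^N\to\mathbb{R}^{q_i}$ be convex with respect to $K_i$. Write $D_t=\{x: g_i(x)\preceq_{K_i}0\ \forall i,\ Ax=b_t\}$ and let $\mathcal X_t$ be the set of minimizers of $c^\top x$ over $D_t$; $x_t^*$ denotes any element of $\mathcal X_t$. Let $\psi_i$ be a generalized logarithm for $K_i$ (a closed concave $C^2$ function on $\operatorname{int}K_i$ with negative definite Hessian and $\psi_i(sy)=\psi_i(y)+\theta_i\log s$ for all $s>0$, for some $\theta_i>0$; for instance $\log$ when $K_i=\mathbb{R}_+$). Let $\phi(x)=-\sum_i\psi_i(-g_i(x))$ with domain $\operatorname{dom}\phi=\{x: g_i(x)\prec_{K_i}0\ \forall i\}$, and $d_\eta(x)=\eta c^\top x+\phi(x)$. For a symmetric matrix $M$ put $\|z\|_M=\sqrt{z^\top Mz}$, and for $y=(x,\nu)\in\mathbb{R}^N\times\mathbb{R}^P$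 put $$\mathbf D(y)=\begin{bmatrix}\nabla^2\phi(x)&A^\top\\A&0\end{bmatrix},\quad r_t(y,\eta)=\begin{bmatrix}\nabla d_\eta(x)+A^\top\nu\\Ax-b_t\end{bmatrix},\quad n_t(y,\eta)=-\mathbf D(y)^{-1}r_t(y,\eta).$$ **Algorithm (OIPM-TEC).** From $y_0=(x_0,\nu_0)$, $\eta_0>0$ and $\beta$, for $t=0,1,2,\dots$: implement $x_t$, observe $b_t$, perform the $t$-step $\tilde y_t=(\tilde x_t,\tilde\nu_t)=y_t+n_t(y_t,\eta_t)$, set $\eta_{t+1}=\beta\eta_t$, and perform the $\eta$-step $y_{t+1}=\tilde y_t-\mathbf D(\tilde y_t)^{-1}\begin{bmatrix}\nabla d_{\eta_{t+1}}(\tilde x_t)+A^\top\nu_t\\0\end{bmatrix}$. (The decisions $x_t$ do not depend on the multiplier used in the last bracket; with $\tilde\nu_t$ in place of $\nu_t$ this is the Newton step $n_t(\tilde y_t,\eta_{t+1})$.) **Performance measures.** With $\operatorname{dist}_i(x)$ the distance from $x$ to $\{z:g_i(z)\preceq_{K_i}0\}$ and $H_d$ the Hausdorff distance, let $$R_d(T)=\sum_{t=1}^T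 c^\top(x_t-x_t^*),\qquad \mathrm{Vio}(T)=\sum_{t=1}^T\Big[\sum_i\operatorname{dist}_i(x_t)+\|Ax_t-b_t\|\Big],$$ $$V_T=\sum_{t=1}^T H_d(\mathcal X_t,\mathcal X_{t-1}),\qquad V_b=\sum_{t=1}^T\|b_t-b_{t-1}\|.$$ **Theorem 1.** Let $v_f,m,\eta_0>0$ and $1<\beta\le 1+\frac1{8\sqrt{v_f}}$. Assume that $\phi$ is a self-concordant barrier functional of complexity at most $v_f$: it is $C^2$ with positive definite Hessian on $\operatorname{dom}\phi$; whenever $x_1\in\operatorname{dom}\phi$ and $\rho:=\|x_2-x_1\|_{\nabla^2\phi(x_1)}<1$, then $x_2\in\operatorname{dom}\phi$ and $\|v\|_{\nabla^2\phi(x_2)}/\|v\|_{\nabla^2\phi(x_1)}\le\frac1{1-\rho}$ for all $v\neq0$; and $\nabla\phi(x)^\top\nabla^2\phi(x)^{-1}\nabla\phi(x)\le v_f$ on $\operatorname{dom}\phi$. Let $x_0\in\operatorname{dom}\phi$ with $Ax_0=b_0$ and $\nu_0\in\mathbb{R}^P$ satisfy $\|n_0(y_0,\eta_0)\|_{\mathbf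 D(y_0)}\le\frac19$. Let $T\ge0$ and assume, for all $0\le t\le T$: $D_t$ is closed, convex and nonempty; $\|\mathbf D(y)^{-1}\|\le\frac1m$ (spectral norm) for all $y=(x,\nu)$ with $x\in D_t\cap\operatorname{dom}\phi$; and $\|b_t-b_{t-1}\|\le\sqrt{3m/160}$ if $t\ge1$. Then for all $t\le T$ the iterates $x_t,\tilde x_t$ lie in $\operatorname{dom}\phi$, the matrices $\mathbf D(y_t),\mathbf D(\tilde y_t)$ are invertible, and $\mathcal X_t$ is nonempty and bounded; moreover $$R_d(T)\le\frac{11v_f\beta}{5\eta_0(\beta-1)}+\|c\|\,V_T,\qquad \mathrm{Vio}(T)\le V_b .$$ Consequently, if the assumptions hold for every $T$, then $R_d(T)=O(V_T+1)$ and $\mathrm{Vio}(T)=O(V_b)$ as $T\to\infty$. -/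

import Mathlib

open Matrix Filter Asymptotics

noncomputable section

namespace OIPM

/-- `ℝⁿ` with the Euclidean norm. -/
abbrev Vec (n : ℕ) := EuclideanSpace ℝ (Fin n)

/-- The product `M x` of a matrix and a Euclidean vector, as a Euclidean vector. -/
def mulV {p n : ℕ} (M : Matrix (Fin p) (Fin n) ℝ) (x : Vec n) : Vec p :=
  WithLp.toLp 2 (M *ᵥ x.ofLp)

/-- The Hessian matrix `∇² f(x)`. -/
def hessian {n : ℕ} (f : Vec n → ℝ) (x : Vec n) : Matrix (Fin n) (Fin n) ℝ :=
  Matrix.of fun i j =>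
    fderiv ℝ (fderiv ℝ f) x (EuclideanSpace.single i 1) (EuclideanSpace.single j 1)

/-- The norm `‖z‖_M = √(zᵀ M z)` induced by a matrix `M`. -/
def matNorm {ι : Type*} [Fintype ι] (M : Matrix ι ι ℝ) (z : ι → ℝ) : ℝ :=
  Real.sqrt (z ⬝ᵥ (M *ᵥ z))

/-- A generalized logarithm for the cone `K`: a concave, closed, twice continuously
differentiable function on the interior of `K`, with negative definite Hessian, which is
logarithmically homogeneous of some degree `θ > 0`. -/
structure IsGeneralizedLog {E : Type*} [NormedAddCommGroup E] [NormedSpace ℝ E]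
    (K : Set E) (ψ : E → ℝ) : Prop where
  concave : ConcaveOn ℝ (interior K) ψ
  closed : ∀ a : ℝ, IsClosed {y | y ∈ interior K ∧ a ≤ ψ y}
  contDiffOn : ContDiffOn ℝ 2 ψ (interior K)
  hess_neg : ∀ y ∈ interior K, ∀ v : E, v ≠ 0 → fderiv ℝ (fderiv ℝ ψ) y v v < 0
  log_homogeneous : ∃ θ : ℝ, 0 < θ ∧
    ∀ y ∈ interior K, ∀ s : ℝ, 0 < s → ψ (s • y) = ψ y + θ * Real.log s

/-- `f` is a (nondegenerate) self-concordant functional with domain `S`: it is `C²` with positive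
definite Hessian on `S`, and for `x₁ ∈ S` every `x₂` with `‖x₂ - x₁‖_{∇²f(x₁)} < 1` lies in the
domain and satisfies `‖v‖_{∇²f(x₂)} / ‖v‖_{∇²f(x₁)} ≤ 1 / (1 - ‖x₂ - x₁‖_{∇²f(x₁)})`. -/
structure IsSelfConcordantOn {n : ℕ} (f : Vec n → ℝ) (S : Set (Vec n)) : Prop where
  contDiffOn : ContDiffOn ℝ 2 f S
  posDef : ∀ x ∈ S, (hessian f x).PosDef
  ball_subset : ∀ x₁ ∈ S, ∀ x₂ : Vec n,
    matNorm (hessian f x₁) (x₂ - x₁).ofLp < 1 → x₂ ∈ S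
  ratio_le : ∀ x₁ ∈ S, ∀ x₂ : Vec n, matNorm (hessian f x₁) (x₂ - x₁).ofLp < 1 →
    ∀ v : Vec n, v ≠ 0 →
      matNorm (hessian f x₂) v.ofLp / matNorm (hessian f x₁) v.ofLp
        ≤ 1 / (1 - matNorm (hessian f x₁) (x₂ - x₁).ofLp)

/-- The data of the time-varying equality-constrained conic problem
`min cᵀx  s.t.  g i x ⪯_{K i} 0 (i = 1, …, I),  A x = b t`.
Mathlib's `ProperCone` is a closed convex cone containing `0`; the fields `K_solid` and
`K_salient` add the nonempty interior and the absence of lines. -/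
structure Problem (N P I : ℕ) where
  c : Vec N
  A : Matrix (Fin P) (Fin N) ℝ
  b : ℕ → Vec P
  q : Fin I → ℕ
  K : (i : Fin I) → ProperCone ℝ (Vec (q i))
  g : (i : Fin I) → Vec N → Vec (q i)
  /-- the generalized logarithm used for the cone `K i` -/
  ψ : (i : Fin I) → Vec (q i) → ℝ
  P_lt_N : P < N
  A_rank : A.rank = P
  K_solid : ∀ i, (interior (K i : Set (Vec (q i)))).Nonempty
  K_salient : ∀ i, ∀ y ∈ K i, y ≠ 0 → -y ∉ K i
  g_convex : ∀ i, ∀ x y : Vec N, ∀ s : ℝ, 0 ≤ s → s ≤ 1 →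
    (s • g i x + (1 - s) • g i y) - g i (s • x + (1 - s) • y) ∈ K i
  ψ_genLog : ∀ i, IsGeneralizedLog (K i : Set (Vec (q i))) (ψ i)

namespace Problem

variable {N P I : ℕ} (pb : Problem N P I)

/-- The objective `f(x) = cᵀ x`. -/
def cost (x : Vec N) : ℝ := inner ℝ pb.c x

/-- `{x | g i x ⪯_{K i} 0}`. -/
def ineqSet (i : Fin I) : Set (Vec N) := {x | -(pb.g i x) ∈ pb.K i}

/-- The feasible set `D_t`. -/
def feasible (t : ℕ) : Set (Vec N) := {x | (∀ i, x ∈ pb.ineqSet i) ∧ mulV pb.A x = pb.b t}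

/-- The set `X_t` of optimal decisions of round `t`. -/
def optimal (t : ℕ) : Set (Vec N) :=
  {x | x ∈ pb.feasible t ∧ ∀ z ∈ pb.feasible t, pb.cost x ≤ pb.cost z}

/-- The domain `{x | g i x ≺_{K i} 0 for all i}` of the barrier. -/
def dom : Set (Vec N) := {x | ∀ i, -(pb.g i x) ∈ interior (pb.K i : Set (Vec (pb.q i)))}

/-- The barrier functional `φ(x) = ∑ i, -log (-g i x)`, with generalized logarithms. -/
def barrier (x : Vec N) : ℝ := ∑ i, -(pb.ψ i (-(pb.g i x)))

/-- `d_η(x) = η cᵀx + φ(x)`. -/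
def penalized (η : ℝ) (x : Vec N) : ℝ := η * pb.cost x + pb.barrier x

/-- The matrix `D(y) = [∇²φ(x), Aᵀ; A, 0]`. -/
def kkt (x : Vec N) : Matrix (Fin N ⊕ Fin P) (Fin N ⊕ Fin P) ℝ :=
  Matrix.fromBlocks (hessian pb.barrier x) pb.Aᵀ pb.A 0

/-- The vector `r_t(y, η) = [∇d_η(x) + Aᵀν; A x - b_t]` at `y = (x, ν)`. -/
def residual (t : ℕ) (η : ℝ) (y : Vec N × Vec P) : Fin N ⊕ Fin P → ℝ :=
  Sum.elim (fun j => gradient (pb.penalized η) y.1 j + (pb.Aᵀ *ᵥ y.2.ofLp) j)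
    (fun k => mulV pb.A y.1 k - pb.b t k)

/-- The infeasible Newton step `n_t(y, η) = -D(y)⁻¹ r_t(y, η)`. -/
def newton (t : ℕ) (η : ℝ) (y : Vec N × Vec P) : Fin N ⊕ Fin P → ℝ :=
  -((pb.kkt y.1)⁻¹ *ᵥ pb.residual t η y)

/-- `y + Δ` for a primal-dual point `y = (x, ν)`. -/
def move (y : Vec N × Vec P) (Δ : Fin N ⊕ Fin P → ℝ) : Vec N × Vec P :=
  (WithLp.toLp 2 fun j => y.1 j + Δ (Sum.inl j), WithLp.toLp 2 fun k => y.2 k + Δ (Sum.inr k))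

/-- The `t`-step. -/
def tStep (t : ℕ) (η : ℝ) (y : Vec N × Vec P) : Vec N × Vec P := move y (pb.newton t η y)

/-- The `η`-step from `y' = (x', ν')`, with `ν` the multiplier in the residual, whose second block
is zero. -/
def etaStep (η : ℝ) (ν : Vec P) (y' : Vec N × Vec P) : Vec N × Vec P :=
  move y' (-((pb.kkt y'.1)⁻¹ *ᵥ
    Sum.elim (fun j => gradient (pb.penalized η) y'.1 j + (pb.Aᵀ *ᵥ ν.ofLp) j) 0))

/-- The barrier parameter `η_t`: `η_{t+1} = η_t β`. -/
def eta (η₀ β : ℝ) : ℕ → ℝ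
  | 0 => η₀
  | t + 1 => eta η₀ β t * β

/-- The iterates `y_t = (x_t, ν_t)` of the algorithm. -/
def iter (η₀ β : ℝ) (y₀ : Vec N × Vec P) : ℕ → Vec N × Vec P
  | 0 => y₀
  | t + 1 =>
    pb.etaStep (eta η₀ β (t + 1)) (iter η₀ β y₀ t).2
      (pb.tStep t (eta η₀ β t) (iter η₀ β y₀ t))

/-- The intermediate iterates `ỹ_t`, obtained from `y_t` by the `t`-step. -/
def mid (η₀ β : ℝ) (y₀ : Vec N × Vec P) (t : ℕ) : Vec N × Vec P :=
  pb.tStep t (eta η₀ β t) (pb.iter η₀ β y₀ t)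

/-- The barrier is a self-concordant barrier functional of complexity (at most) `vf`. -/
structure BarrierComplexity (vf : ℝ) : Prop where
  selfConcordant : IsSelfConcordantOn pb.barrier pb.dom
  complexity_le : ∀ x ∈ pb.dom,
    (gradient pb.barrier x).ofLp ⬝ᵥ
      ((hessian pb.barrier x)⁻¹ *ᵥ (gradient pb.barrier x).ofLp) ≤ vf

/-- The assumptions on the rounds `0, …, T`: each feasible set is closed, convex and nonempty;
`‖D(y)⁻¹‖ ≤ 1 / m` (spectral norm) at the feasible points where the barrier is defined; and
consecutive right-hand sides differ by at most `√(3m/160)`. -/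
structure RegularUpTo (m : ℝ) (T : ℕ) : Prop where
  closed : ∀ t ≤ T, IsClosed (pb.feasible t)
  convex : ∀ t ≤ T, Convex ℝ (pb.feasible t)
  nonempty : ∀ t ≤ T, (pb.feasible t).Nonempty
  kkt_inv_le : ∀ t ≤ T, ∀ x ∈ pb.feasible t, x ∈ pb.dom →
    ‖Matrix.toEuclideanCLM (n := Fin N ⊕ Fin P) (𝕜 := ℝ) (pb.kkt x)⁻¹‖ ≤ 1 / m
  step_le : ∀ t, 1 ≤ t → t ≤ T → ‖pb.b t - pb.b (t - 1)‖ ≤ Real.sqrt (3 * m / 160)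

/-- Dynamic regret of the decisions `x` against the round-optimal decisions `xs`. -/
def regret (x xs : ℕ → Vec N) (T : ℕ) : ℝ :=
  ∑ t ∈ Finset.Icc 1 T, (pb.cost (x t) - pb.cost (xs t))

/-- Constraint violation `Vio(T)` of the decisions `x`. -/
def violation (x : ℕ → Vec N) (T : ℕ) : ℝ :=
  ∑ t ∈ Finset.Icc 1 T,
    ((∑ i, Metric.infDist (x t) (pb.ineqSet i)) + ‖mulV pb.A (x t) - pb.b t‖)

/-- `V_T`, the cumulative Hausdorff variation of the optimal sets. -/
def optVariation (T : ℕ) : ℝ :=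
  ∑ t ∈ Finset.Icc 1 T, Metric.hausdorffDist (pb.optimal t) (pb.optimal (t - 1))

/-- `V_b`, the cumulative variation of the right-hand sides. -/
def rhsVariation (T : ℕ) : ℝ := ∑ t ∈ Finset.Icc 1 T, ‖pb.b t - pb.b (t - 1)‖

end Problem

end OIPM

end

/-! The run is controlled by the dual local norm of the derivative of `d_η` on the kernel of `A`
(`Centered`), where the multiplier is invisible. The invariant (`iter_spec`) is that `x_t` lies in
the domain, has decrement at most 1/9 for `η_t`, and solves `A x = b_{t-1}` (`A x = b_0` when t =
0).

A Newton step of squared local length at most ρ ≤ 1/25 leaves a decrement of at most 15ρ/8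
(`IsNewtonStep.centered_add`). The direction of the t-step splits Hessian-orthogonally into a kernel
part of length at most 1/9 and a shift absorbing the change of `b`, so ρ = 1/81 + 3/160. Raising `η`
by the factor `β` then brings the decrement to at most 1/5, and the η-step returns it below 1/9.

For the regret, the barrier inequality bounds the suboptimality of `x_t` over `D_{t-1}` by
11·vf/(5·η_t) (`BarrierComplexity.gap_le`). These terms sum geometrically, and passing from round
t-1 to round t costs ‖c‖ times a Hausdorff distance. For the violation, no inequality is ever
violated, and the equality residual at `x_t` is exactly `b_{t-1} - b_t`. -/

namespace OIPM

/-! ### Self-concordance: comparison of local norms and Newton estimates. -/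

section SelfConcordant

variable {n : ℕ} {f : Vec n → ℝ} {S : Set (Vec n)}

/-- The Hessian of `f` at `x` as a bilinear form. -/
noncomputable def hessForm (f : Vec n → ℝ) (x v w : Vec n) : ℝ := fderiv ℝ (fderiv ℝ f) x v w

/-- The local norm `‖v‖_{∇²f(x)}`. -/
noncomputable def localNorm (f : Vec n → ℝ) (x v : Vec n) : ℝ := Real.sqrt (hessForm f x v v)

lemma sum_smul_single (v : Vec n) : ∑ i, v i • EuclideanSpace.single i (1 : ℝ) = v := by
  simpa using (EuclideanSpace.basisFun (Fin n) ℝ).sum_repr v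

lemma dotProduct_hessian_mulVec (f : Vec n → ℝ) (x v w : Vec n) :
    v.ofLp ⬝ᵥ (hessian f x *ᵥ w.ofLp) = hessForm f x v w := by
  unfold hessForm
  conv_rhs => rw [← sum_smul_single v, ← sum_smul_single w]
  simp only [dotProduct, Matrix.mulVec, hessian, Matrix.of_apply, Finset.mul_sum, map_sum, map_smul,
    _root_.sum_apply, _root_.smul_apply, smul_eq_mul]
  rw [Finset.sum_comm]
  exact Finset.sum_congr rfl fun i _ => Finset.sum_congr rfl fun j _ => by ring

lemma matNorm_hessian (f : Vec n → ℝ) (x v : Vec n) :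
    matNorm (hessian f x) v.ofLp = localNorm f x v := by
  unfold matNorm localNorm; rw [dotProduct_hessian_mulVec]

lemma gradient_dotProduct (f : Vec n → ℝ) (x v : Vec n) :
    (gradient f x).ofLp ⬝ᵥ v.ofLp = fderiv ℝ f x v := by
  rw [← inner_gradient_left, EuclideanSpace.inner_eq_star_dotProduct, dotProduct_comm]
  simp

lemma hessForm_add_left (x u v w : Vec n) :
    hessForm f x (u + v) w = hessForm f x u w + hessForm f x v w := by simp [hessForm]

lemma hessForm_add_right (x u v w : Vec n) :
    hessForm f x u (v + w) = hessForm f x u v + hessForm f x u w := by simp [hessForm]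

lemma hessForm_smul_left (x v w : Vec n) (a : ℝ) :
    hessForm f x (a • v) w = a * hessForm f x v w := by simp [hessForm]

lemma hessForm_smul_right (x v w : Vec n) (a : ℝ) :
    hessForm f x v (a • w) = a * hessForm f x v w := by simp [hessForm]

lemma localNorm_nonneg (x v : Vec n) : 0 ≤ localNorm f x v := Real.sqrt_nonneg _

lemma localNorm_smul (x v : Vec n) (a : ℝ) :
    localNorm f x (a • v) = |a| * localNorm f x v := by
  unfold localNorm
  rw [hessForm_smul_left, hessForm_smul_right, ← mul_assoc, Real.sqrt_mul (mul_self_nonneg a),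
    Real.sqrt_mul_self_eq_abs]

lemma localNorm_neg (x v : Vec n) : localNorm f x (-v) = localNorm f x v := by
  simp [localNorm, hessForm]

lemma localNorm_zero (x : Vec n) : localNorm f x 0 = 0 := by simp [localNorm, hessForm]

lemma continuous_localNorm (x : Vec n) : Continuous (localNorm f x) := by
  unfold localNorm hessForm
  fun_prop

lemma localNorm_smul_sub {x h : Vec n} {s : ℝ} (hs : 0 ≤ s) :
    localNorm f x (x + s • h - x) = s * localNorm f x h := by
  rw [add_sub_cancel_left, localNorm_smul, abs_of_nonneg hs]

namespace IsSelfConcordantOn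

variable (hf : IsSelfConcordantOn f S)
include hf

lemma hessForm_pos {x : Vec n} (hx : x ∈ S) {v : Vec n} (hv : v ≠ 0) : 0 < hessForm f x v v := by
  have h := (hf.posDef x hx).dotProduct_mulVec_pos (x := v.ofLp) (by simpa using hv)
  simpa [← dotProduct_hessian_mulVec] using h

lemma hessForm_nonneg {x : Vec n} (hx : x ∈ S) (v : Vec n) : 0 ≤ hessForm f x v v := by
  rcases eq_or_ne v 0 with rfl | hv
  · simp [hessForm]
  · exact (hf.hessForm_pos hx hv).le

lemma hessForm_comm {x : Vec n} (hx : x ∈ S) (v w : Vec n) :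
    hessForm f x v w = hessForm f x w v := by
  have h : (hessian f x)ᵀ = hessian f x := by
    simpa only [Matrix.IsHermitian, Matrix.conjTranspose_eq_transpose_of_trivial]
      using (hf.posDef x hx).1
  rw [← dotProduct_hessian_mulVec, ← dotProduct_hessian_mulVec, Matrix.dotProduct_mulVec,
    ← Matrix.mulVec_transpose, h, dotProduct_comm]

lemma localNorm_sq {x : Vec n} (hx : x ∈ S) (v : Vec n) :
    localNorm f x v ^ 2 = hessForm f x v v := Real.sq_sqrt (hf.hessForm_nonneg hx v)

lemma localNorm_pos {x : Vec n} (hx : x ∈ S) {v : Vec n} (hv : v ≠ 0) : 0 < localNorm f x v :=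
  Real.sqrt_pos.2 (hf.hessForm_pos hx hv)

/-- Cauchy–Schwarz for the Hessian. -/
lemma hessForm_le_mul {x : Vec n} (hx : x ∈ S) (v w : Vec n) :
    hessForm f x v w ≤ localNorm f x v * localNorm f x w := by
  rcases eq_or_ne v 0 with rfl | hv
  · simp [localNorm_zero, hessForm]
  rcases eq_or_ne w 0 with rfl | hw
  · simp [localNorm_zero, hessForm]
  have hpv := hf.localNorm_pos hx hv
  have hpw := hf.localNorm_pos hx hw
  have h := hf.hessForm_nonneg hx (localNorm f x w • v + (-localNorm f x v) • w)
  simp only [hessForm_add_left, hessForm_add_right, hessForm_smul_left,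
    hessForm_smul_right] at h
  rw [hf.hessForm_comm hx w v, ← hf.localNorm_sq hx v, ← hf.localNorm_sq hx w] at h
  have hvw := mul_pos hpv hpw
  refine le_of_mul_le_mul_left ?_ hvw
  nlinarith

lemma mem_of_localNorm_lt {x y : Vec n} (hx : x ∈ S) (hy : localNorm f x (y - x) < 1) : y ∈ S :=
  hf.ball_subset x hx y (by rwa [matNorm_hessian])

lemma isOpen : IsOpen S := by
  rw [isOpen_iff_mem_nhds]
  intro x hx
  have hc : Continuous fun y => localNorm f x (y - x) :=
    (continuous_localNorm x).comp (continuous_id.sub continuous_const)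
  have h0 : localNorm f x (x - x) < 1 := by simp [localNorm_zero]
  filter_upwards [hc.continuousAt.eventually_lt continuousAt_const h0] with y hy
  exact hf.mem_of_localNorm_lt hx hy

lemma hasFDerivAt_fderiv {x : Vec n} (hx : x ∈ S) :
    HasFDerivAt (fderiv ℝ f) (fderiv ℝ (fderiv ℝ f) x) x := by
  have h : ContDiffAt ℝ 2 f x := hf.contDiffOn.contDiffAt (hf.isOpen.mem_nhds hx)
  exact ((h.fderiv_right (m := 1) (by norm_num)).differentiableAt (by norm_num)).hasFDerivAt

lemma differentiableAt {x : Vec n} (hx : x ∈ S) : DifferentiableAt ℝ f x :=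
  (hf.contDiffOn.contDiffAt (hf.isOpen.mem_nhds hx)).differentiableAt (by norm_num)

lemma hasDerivAt_fderiv_line (x v w : Vec n) {s : ℝ} (hs : x + s • v ∈ S) :
    HasDerivAt (fun s : ℝ => fderiv ℝ f (x + s • v) w) (hessForm f (x + s • v) v w) s := by
  have h1 : HasDerivAt (fun s : ℝ => x + s • v) v s := by
    simpa using ((hasDerivAt_id s).smul_const v).const_add x
  have h2 := (hf.hasFDerivAt_fderiv hs).comp_hasDerivAt s h1
  exact h2.clm_apply (hasDerivAt_const s w) |>.congr_deriv (by simp [hessForm])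

lemma one_sub_mul_localNorm_le {x y : Vec n} (hx : x ∈ S) (hy : localNorm f x (y - x) < 1)
    (w : Vec n) : (1 - localNorm f x (y - x)) * localNorm f y w ≤ localNorm f x w := by
  rcases eq_or_ne w 0 with rfl | hw
  · simp [localNorm_zero]
  have h := hf.ratio_le x hx y (by rwa [matNorm_hessian]) w hw
  simp only [matNorm_hessian] at h
  rw [div_le_div_iff₀ (hf.localNorm_pos hx hw) (by linarith)] at h
  linarith

/-- The reverse comparison of local norms that follows by exchanging the two points. -/
lemma one_sub_two_mul_localNorm_le {x y : Vec n} (hx : x ∈ S)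
    (hy : localNorm f x (y - x) < 1 / 2) (w : Vec n) :
    (1 - 2 * localNorm f x (y - x)) * localNorm f x w
      ≤ (1 - localNorm f x (y - x)) * localNorm f y w := by
  set a := localNorm f x (y - x) with ha
  have hyS : y ∈ S := hf.mem_of_localNorm_lt hx (by linarith)
  -- Seen from `y` the distance is at most a/(1-a), which is below 1 since a < 1/2; so `y` may serve
  -- as the base point.
  have h1 : (1 - a) * localNorm f y (x - y) ≤ a := by
    have := hf.one_sub_mul_localNorm_le hx (by linarith) (y - x)
    rwa [← localNorm_neg y, neg_sub, ← ha] at this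
  have hlt : localNorm f y (x - y) < 1 := by
    by_contra! hcon
    nlinarith
  have h2 := hf.one_sub_mul_localNorm_le hyS hlt w
  nlinarith [localNorm_nonneg (f := f) x w]

/-- Squaring the norm comparisons bounds the quadratic forms, and polarization extends this to the
bilinear form. The function (1-a)⁻² - 1 is convex with value 9/16 at a = 1/5, so its chord on [0,
1/5] has slope 45/16. -/
lemma abs_hessForm_sub_le {x y : Vec n} (hx : x ∈ S) (hy : localNorm f x (y - x) ≤ 1 / 5)
    (v w : Vec n) :
    |hessForm f y v w - hessForm f x v w|
      ≤ 45 / 16 * localNorm f x (y - x) * (localNorm f x v * localNorm f x w) := by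
  set a := localNorm f x (y - x) with ha
  have ha0 : 0 ≤ a := localNorm_nonneg _ _
  have hyS : y ∈ S := hf.mem_of_localNorm_lt hx (by linarith)
  have hquad : ∀ u : Vec n, |hessForm f y u u - hessForm f x u u|
      ≤ 45 / 16 * a * hessForm f x u u := by
    intro u
    have h1 := hf.one_sub_mul_localNorm_le (y := y) hx (by linarith) u
    have h2 := hf.one_sub_two_mul_localNorm_le (y := y) hx (by linarith) u
    rw [← ha] at h1 h2
    rw [← hf.localNorm_sq hx, ← hf.localNorm_sq hyS]
    set p := localNorm f x u
    set q := localNorm f y u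
    have hp : 0 ≤ p := localNorm_nonneg _ _
    have hq : 0 ≤ q := localNorm_nonneg _ _
    have h1' : ((1 - a) * q) ^ 2 ≤ p ^ 2 := pow_le_pow_left₀ (by nlinarith) h1 2
    have h2' : ((1 - 2 * a) * p) ^ 2 ≤ ((1 - a) * q) ^ 2 := pow_le_pow_left₀ (by nlinarith) h2 2
    have hpos : 0 < (1 - a) ^ 2 := by nlinarith
    have hpoly : 1 ≤ (1 - a) ^ 2 * (1 + 45 / 16 * a) := by
      nlinarith [mul_nonneg ha0 (sub_nonneg.2 hy), mul_nonneg (mul_nonneg ha0 ha0) (sub_nonneg.2 hy)]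
    have hpoly' : (1 - a) ^ 2 * (1 - 45 / 16 * a) ≤ (1 - 2 * a) ^ 2 := by
      nlinarith [mul_nonneg ha0 (sub_nonneg.2 hy), mul_nonneg (mul_nonneg ha0 ha0) (sub_nonneg.2 hy)]
    rw [abs_le]
    constructor
    · have : (1 - a) ^ 2 * ((1 - 45 / 16 * a) * p ^ 2) ≤ (1 - a) ^ 2 * q ^ 2 := by
        nlinarith [sq_nonneg p, mul_le_mul_of_nonneg_right hpoly' (sq_nonneg p)]
      nlinarith [le_of_mul_le_mul_left this hpos]
    · have : (1 - a) ^ 2 * q ^ 2 ≤ (1 - a) ^ 2 * ((1 + 45 / 16 * a) * p ^ 2) := by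
        nlinarith [sq_nonneg p, mul_le_mul_of_nonneg_right hpoly (sq_nonneg p)]
      nlinarith [le_of_mul_le_mul_left this hpos]
  have hpolar : ∀ u z : Vec n, 2 * |hessForm f y u z - hessForm f x u z|
      ≤ 45 / 16 * a * (hessForm f x u u + hessForm f x z z) := by
    intro u z
    have e1 := abs_le.1 (hquad (u + z))
    have e2 := abs_le.1 (hquad (u - z))
    rw [sub_eq_add_neg u z, ← neg_one_smul ℝ z] at e2
    simp only [hessForm_add_left, hessForm_add_right, hessForm_smul_left,
      hessForm_smul_right] at e1 e2
    rw [hf.hessForm_comm hx z u, hf.hessForm_comm hyS z u] at e1 e2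
    rw [← le_div_iff₀' two_pos, abs_le]
    constructor <;> linarith [e1.1, e1.2, e2.1, e2.2]
  rcases eq_or_ne v 0 with rfl | hv
  · simp [hessForm, localNorm_zero]
  rcases eq_or_ne w 0 with rfl | hw
  · simp [hessForm, localNorm_zero]
  have hpv := hf.localNorm_pos hx hv
  have hpw := hf.localNorm_pos hx hw
  -- Scaling each vector by the norm of the other equalizes their lengths, which turns the sum of
  -- squares into a product of norms.
  have h := hpolar ((localNorm f x w) • v) ((localNorm f x v) • w)
  simp only [hessForm_smul_left, hessForm_smul_right] at h
  rw [← hf.localNorm_sq hx, ← hf.localNorm_sq hx, ← mul_sub, ← mul_sub, abs_mul, abs_mul,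
    abs_of_pos hpv, abs_of_pos hpw] at h
  have hvw := mul_pos hpv hpw
  refine le_of_mul_le_mul_left ?_ hvw
  nlinarith

/-- The error of the linearization of the gradient along a short step. -/
lemma fderiv_add_sub_le {x h : Vec n} (hx : x ∈ S) (hh : localNorm f x h ≤ 1 / 5) (v : Vec n) :
    fderiv ℝ f (x + h) v - fderiv ℝ f x v - hessForm f x h v
      ≤ 45 / 32 * localNorm f x h ^ 2 * localNorm f x v := by
  set r := localNorm f x h with hr
  have hr0 : 0 ≤ r := localNorm_nonneg _ _
  have hstep : ∀ s ∈ Set.Icc (0 : ℝ) 1, localNorm f x (x + s • h - x) ≤ 1 / 5 := by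
    intro s hs
    rw [localNorm_smul_sub hs.1]
    nlinarith [hs.1, hs.2]
  have hmem : ∀ s ∈ Set.Icc (0 : ℝ) 1, x + s • h ∈ S := fun s hs =>
    hf.mem_of_localNorm_lt hx (by linarith [hstep s hs])
  have hd : ∀ s ∈ Set.Icc (0 : ℝ) 1, HasDerivAt
      (fun s : ℝ => fderiv ℝ f (x + s • h) v) (hessForm f (x + s • h) h v) s := fun s hs =>
    hf.hasDerivAt_fderiv_line x h v (hmem s hs)
  -- The comparison function integrates the Hessian error 45/16·s·r, whence 45/32.
  have hB : ∀ s : ℝ, HasDerivAt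
      (fun s : ℝ => fderiv ℝ f x v + s * hessForm f x h v
        + 45 / 32 * r ^ 2 * localNorm f x v * s ^ 2)
      (hessForm f x h v + 45 / 16 * (s * r) * (r * localNorm f x v)) s := by
    intro s
    have := (((hasDerivAt_id s).mul_const (hessForm f x h v)).const_add (fderiv ℝ f x v)).add
      ((hasDerivAt_pow 2 s).const_mul (45 / 32 * r ^ 2 * localNorm f x v))
    refine this.congr_deriv ?_
    simp; ring
  have key := image_le_of_deriv_right_le_deriv_boundary
    (fun s hs => (hd s hs).continuousAt.continuousWithinAt)
    (fun s hs => (hd s ⟨hs.1, hs.2.le⟩).hasDerivWithinAt) (by simp)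
    (fun s _ => (hB s).continuousAt.continuousWithinAt)
    (fun s _ => (hB s).hasDerivWithinAt)
    (fun s hs => by
      have := (abs_le.1 (hf.abs_hessForm_sub_le hx (hstep s ⟨hs.1, hs.2.le⟩) h v)).2
      rw [localNorm_smul_sub hs.1] at this
      linarith) (Set.right_mem_Icc.2 zero_le_one)
  simp only [one_smul, one_mul, one_pow, mul_one] at key
  linarith

/-- The Newton equation cancels the linear part, so only the quadratic error remains. Measuring `v`
at `x + h` costs a factor (1-r)/(1-2r) ≤ 4/3, and 45/32 · 4/3 = 15/8. -/
lemma fderiv_add_le_of_newton {x h v : Vec n} {d : ℝ} (hx : x ∈ S)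
    (hh : localNorm f x h ≤ 1 / 5) (hv : d + fderiv ℝ f x v + hessForm f x h v = 0) :
    d + fderiv ℝ f (x + h) v ≤ 15 / 8 * localNorm f x h ^ 2 * localNorm f (x + h) v := by
  have h1 := hf.fderiv_add_sub_le hx hh v
  have h2 := hf.one_sub_two_mul_localNorm_le (y := x + h) hx
    (by rw [add_sub_cancel_left]; linarith) v
  rw [add_sub_cancel_left] at h2
  set r := localNorm f x h
  have hr0 : 0 ≤ r := localNorm_nonneg _ _
  have hv0 := localNorm_nonneg (f := f) x v
  have hv1 := localNorm_nonneg (f := f) (x + h) v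
  have h3 : localNorm f x v ≤ 4 / 3 * localNorm f (x + h) v := by nlinarith
  nlinarith [mul_le_mul_of_nonneg_left h3 (sq_nonneg r)]

/-- The directional derivative grows by a definite amount inside the Dikin ellipsoid. -/
lemma fderiv_add_smul_ge {x v : Vec n} (hx : x ∈ S) {s : ℝ} (hs : 0 < s)
    (hsv : s * localNorm f x v ≤ 1 / 5) :
    fderiv ℝ f x v + s * (9 / 16 * localNorm f x v ^ 2) ≤ fderiv ℝ f (x + s • v) v := by
  have hmem : ∀ u ∈ Set.Icc (0 : ℝ) s, localNorm f x (x + u • v - x) ≤ 1 / 5 := by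
    intro u hu
    rw [localNorm_smul_sub hu.1]
    nlinarith [hu.2, localNorm_nonneg (f := f) x v]
  have hS : ∀ u ∈ Set.Icc (0 : ℝ) s, x + u • v ∈ S := fun u hu =>
    hf.mem_of_localNorm_lt hx (by linarith [hmem u hu])
  obtain ⟨u, hu, hslope⟩ := exists_hasDerivAt_eq_slope
    (fun u : ℝ => fderiv ℝ f (x + u • v) v) (fun u => hessForm f (x + u • v) v v) hs
    (fun u hu => (hf.hasDerivAt_fderiv_line x v v (hS u hu)).continuousAt.continuousWithinAt)
    (fun u hu => hf.hasDerivAt_fderiv_line x v v (hS u ⟨hu.1.le, hu.2.le⟩))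
  have hu' : u ∈ Set.Icc (0 : ℝ) s := ⟨hu.1.le, hu.2.le⟩
  have h2 := hf.one_sub_two_mul_localNorm_le (y := x + u • v) hx
    (by linarith [hmem u hu']) v
  have h3 := hmem u hu'
  set a := localNorm f x (x + u • v - x)
  have ha0 : 0 ≤ a := localNorm_nonneg _ _
  have hv0 := localNorm_nonneg (f := f) x v
  have hv1 := localNorm_nonneg (f := f) (x + u • v) v
  have h4 : 3 / 4 * localNorm f x v ≤ localNorm f (x + u • v) v := by nlinarith
  have h5 : 9 / 16 * localNorm f x v ^ 2 ≤ hessForm f (x + u • v) v v := by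
    rw [← hf.localNorm_sq (hS u hu')]
    nlinarith
  rw [hslope, sub_zero, zero_smul, add_zero, le_div_iff₀ hs] at h5
  linarith

/-- A bound on the Newton decrements that holds on the whole domain can be improved as long as it
is below `9 / 20`. -/
lemma fderiv_le_improve {L : ℝ} (hL0 : 0 ≤ L)
    (hL : ∀ x ∈ S, ∀ v, fderiv ℝ f x v ≤ L * localNorm f x v) {x : Vec n} (hx : x ∈ S)
    (v : Vec n) : fderiv ℝ f x v ≤ (5 / 4 * L - 9 / 80) * localNorm f x v := by
  rcases eq_or_ne v 0 with rfl | hv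
  · simp [localNorm_zero]
  have hr := hf.localNorm_pos hx hv
  set r := localNorm f x v with hr'
  -- This step has local length exactly 1/5. The derivative gains 9/80·r along it, while the bound
  -- `L` at its end costs only a factor 5/4.
  have hs : 0 < 1 / (5 * r) := by positivity
  have hsr : 1 / (5 * r) * r = 1 / 5 := by field_simp
  have h1 := hf.fderiv_add_smul_ge hx hs hsr.le
  have hball : localNorm f x (x + (1 / (5 * r)) • v - x) = 1 / 5 := by
    rw [localNorm_smul_sub hs.le, ← hr', hsr]
  have hyS := hf.mem_of_localNorm_lt hx (y := x + (1 / (5 * r)) • v) (by rw [hball]; norm_num)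
  have h2 := hL _ hyS v
  have h3 := hf.one_sub_mul_localNorm_le (y := x + (1 / (5 * r)) • v) hx
    (by rw [hball]; norm_num) v
  rw [hball, ← hr'] at h3
  rw [← hr'] at h1
  have h4 : 1 / (5 * r) * (9 / 16 * r ^ 2) = 9 / 80 * r := by field_simp; norm_num
  rw [h4] at h1
  nlinarith

/-- The improvement map L ↦ 5L/4 - 9/80 has fixed point 9/20 and would push any smaller bound down
forever, so the infimum of the valid bounds is at least 9/20. -/
lemma le_of_fderiv_le (hS : S.Nonempty) (hn : 0 < n) {L : ℝ}
    (hL : ∀ x ∈ S, ∀ v, fderiv ℝ f x v ≤ L * localNorm f x v) : 9 / 20 ≤ L := by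
  set B : Set ℝ := {L | ∀ x ∈ S, ∀ v, fderiv ℝ f x v ≤ L * localNorm f x v} with hB
  -- A nonzero direction tested with both signs excludes negative bounds; this needs positive
  -- dimension.
  have hB0 : ∀ M ∈ B, 0 ≤ M := by
    intro M hM
    obtain ⟨x, hx⟩ := hS
    have hv : (EuclideanSpace.single ⟨0, hn⟩ 1 : Vec n) ≠ 0 := by simp
    have hp := hf.localNorm_pos hx hv
    have h1 := hM x hx (EuclideanSpace.single ⟨0, hn⟩ 1)
    have h2 := hM x hx (-EuclideanSpace.single ⟨0, hn⟩ 1)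
    rw [localNorm_neg, map_neg] at h2
    by_contra! hneg
    nlinarith
  have hbdd : BddBelow B := ⟨0, hB0⟩
  have h1 : ∀ M ∈ B, 4 / 5 * (sInf B + 9 / 80) ≤ M := by
    intro M hM
    have := csInf_le hbdd (show 5 / 4 * M - 9 / 80 ∈ B from
      fun x hx v => hf.fderiv_le_improve (hB0 M hM) hM hx v)
    linarith
  have h2 := le_csInf (s := B) ⟨L, hL⟩ h1
  have h3 := csInf_le hbdd (show L ∈ B from hL)
  linarith

end IsSelfConcordantOn

/-! ### Consequences of bounded complexity. -/

/-- `f` has complexity at most `vf`: the dual local norms of the derivatives are at most `√vf`. -/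
lemma IsSelfConcordantOn.fderiv_le_sqrt_mul (hf : IsSelfConcordantOn f S) {vf : ℝ} {x : Vec n}
    (hx : x ∈ S)
    (hc : (gradient f x).ofLp ⬝ᵥ ((hessian f x)⁻¹ *ᵥ (gradient f x).ofLp) ≤ vf) (v : Vec n) :
    fderiv ℝ f x v ≤ Real.sqrt vf * localNorm f x v := by
  set w : Vec n := WithLp.toLp 2 ((hessian f x)⁻¹ *ᵥ (gradient f x).ofLp) with hw
  have hdet : IsUnit (hessian f x).det := (hf.posDef x hx).det_pos.ne'.isUnit
  have hHw : hessian f x *ᵥ w.ofLp = (gradient f x).ofLp := by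
    simp [hw, Matrix.mulVec_mulVec, Matrix.mul_nonsing_inv _ hdet]
  have hform : ∀ u : Vec n, hessForm f x u w = fderiv ℝ f x u := by
    intro u
    rw [← dotProduct_hessian_mulVec, hHw, dotProduct_comm, gradient_dotProduct]
  have hww : hessForm f x w w ≤ vf := by
    rw [hform, ← gradient_dotProduct]; exact hc
  have hCS := hf.hessForm_le_mul hx v w
  rw [hform, mul_comm] at hCS
  refine hCS.trans (mul_le_mul_of_nonneg_right (Real.sqrt_le_sqrt hww) (localNorm_nonneg _ _))

/-- The barrier inequality along a segment whose half-open part lies in the domain. -/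
lemma IsSelfConcordantOn.fderiv_segment_le (hf : IsSelfConcordantOn f S) {vf : ℝ} (hvf : 0 < vf)
    (hL : ∀ x ∈ S, ∀ v, fderiv ℝ f x v ≤ Real.sqrt vf * localNorm f x v) {x h : Vec n}
    (hseg : ∀ s : ℝ, 0 ≤ s → s < 1 → x + s • h ∈ S) : fderiv ℝ f x h ≤ vf := by
  by_contra! hcon
  set g : ℝ → ℝ := fun s => fderiv ℝ f (x + s • h) h with hg
  have hg0 : g 0 = fderiv ℝ f x h := by simp [hg]
  -- By complexity g' ≥ g²/vf, so 1/g falls at rate at least 1/vf and would reach zero by time `τ` <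
  -- 1, still inside the domain.
  set τ := vf / g 0 with hτ
  have hg0pos : 0 < g 0 := by rw [hg0]; linarith
  have hτ0 : 0 < τ := by positivity
  have hτ1 : τ < 1 := by rw [hτ, div_lt_one hg0pos, hg0]; exact hcon
  have hmem : ∀ s ∈ Set.Icc 0 τ, x + s • h ∈ S := fun s hs => hseg s hs.1 (hs.2.trans_lt hτ1)
  have hder : ∀ s ∈ Set.Icc 0 τ, HasDerivAt g (hessForm f (x + s • h) h h) s := fun s hs =>
    hf.hasDerivAt_fderiv_line x h h (hmem s hs)
  have hcont : ContinuousOn g (Set.Icc 0 τ) := fun s hs =>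
    (hder s hs).continuousAt.continuousWithinAt
  have hint : ∀ s ∈ interior (Set.Icc 0 τ), s ∈ Set.Icc 0 τ := fun s hs => interior_subset hs
  have hmono : MonotoneOn g (Set.Icc 0 τ) :=
    monotoneOn_of_hasDerivWithinAt_nonneg (convex_Icc 0 τ) hcont
      (fun s hs => (hder s (hint s hs)).hasDerivWithinAt)
      (fun s hs => hf.hessForm_nonneg (hmem s (hint s hs)) h)
  have hpos : ∀ s ∈ Set.Icc 0 τ, 0 < g s := fun s hs =>
    hg0pos.trans_le (hmono ⟨le_rfl, hτ0.le⟩ hs hs.1)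
  have hder' : ∀ s ∈ Set.Icc 0 τ, HasDerivAt (fun s => (g s)⁻¹ + s * vf⁻¹)
      (-hessForm f (x + s • h) h h / g s ^ 2 + vf⁻¹) s := fun s hs => by
    exact (((hder s hs).inv (hpos s hs).ne').add
      ((hasDerivAt_id s).mul_const vf⁻¹)).congr_deriv (by simp)
  have hanti : AntitoneOn (fun s => (g s)⁻¹ + s * vf⁻¹) (Set.Icc 0 τ) := by
    refine antitoneOn_of_hasDerivWithinAt_nonpos (convex_Icc 0 τ)
      (fun s hs => (hder' s hs).continuousAt.continuousWithinAt)
      (fun s hs => (hder' s (hint s hs)).hasDerivWithinAt) (fun s hs => ?_)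
    have hs' := hint s hs
    have hb := hL _ (hmem s hs') h
    have hsq : g s ^ 2 ≤ vf * hessForm f (x + s • h) h h := by
      rw [← hf.localNorm_sq (hmem s hs')]
      nth_rw 1 [← Real.sq_sqrt hvf.le]
      rw [← mul_pow]
      exact pow_le_pow_left₀ (hpos s hs').le hb 2
    have hp := hpos s hs'
    have : vf⁻¹ ≤ hessForm f (x + s • h) h h / g s ^ 2 := by
      rw [le_div_iff₀ (by positivity), inv_mul_le_iff₀ hvf]; exact hsq
    rw [neg_div]; linarith
  have hfin := hanti ⟨le_rfl, hτ0.le⟩ ⟨hτ0.le, le_rfl⟩ hτ0.le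
  have hτg : τ * vf⁻¹ = (g 0)⁻¹ := by rw [hτ]; field_simp
  have := inv_pos.2 (hpos τ ⟨hτ0.le, le_rfl⟩)
  simp only [hτg, zero_mul, add_zero] at hfin
  linarith

/-- Along the first local length 1/5 the derivative gains 9/80·r; the barrier inequality then
applies to the remaining segment, at least 4/5 of the whole. The term linear in r later absorbs the
centering error and gives compactness. -/
lemma IsSelfConcordantOn.fderiv_segment_le_of_one_le (hf : IsSelfConcordantOn f S) {vf : ℝ}
    (hvf : 0 < vf) (hL : ∀ x ∈ S, ∀ v, fderiv ℝ f x v ≤ Real.sqrt vf * localNorm f x v)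
    {x h : Vec n} (hseg : ∀ s : ℝ, 0 ≤ s → s < 1 → x + s • h ∈ S) (hr : 1 ≤ localNorm f x h) :
    fderiv ℝ f x h ≤ 5 / 4 * vf - 9 / 80 * localNorm f x h := by
  have hx : x ∈ S := by simpa using hseg 0 le_rfl one_pos
  set r := localNorm f x h with hr'
  set s := 1 / (5 * r) with hs'
  have hs : 0 < s := by positivity
  have hs1 : s ≤ 1 / 5 := by
    rw [hs', div_le_div_iff₀ (by positivity) (by norm_num)]; linarith
  have hsr : s * r = 1 / 5 := by rw [hs']; field_simp
  have h1 := hf.fderiv_add_smul_ge hx hs hsr.le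
  have h2 := hf.fderiv_segment_le hvf hL (x := x + s • h) (h := (1 - s) • h) (fun t ht ht1 => by
    rw [smul_smul, add_assoc, ← add_smul]
    exact hseg _ (by nlinarith) (by nlinarith))
  rw [map_smul, smul_eq_mul] at h2
  rw [← hr'] at h1
  have h4 : s * (9 / 16 * r ^ 2) = 9 / 80 * r := by
    rw [show s * (9 / 16 * r ^ 2) = 9 / 16 * (s * r) * r by ring, hsr]; ring
  rw [h4] at h1
  have h5 : fderiv ℝ f (x + s • h) h ≤ 5 / 4 * vf := by
    by_contra! hcon
    nlinarith
  linarith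

end SelfConcordant

end OIPM

/-! ### The KKT system and the geometry of the domain. -/

namespace OIPM

section MulV

variable {p n : ℕ} (M : Matrix (Fin p) (Fin n) ℝ)

lemma mulV_add (x y : Vec n) : mulV M (x + y) = mulV M x + mulV M y := by
  ext i; simp [mulV, Matrix.mulVec_add]

lemma mulV_sub (x y : Vec n) : mulV M (x - y) = mulV M x - mulV M y := by
  ext i; simp [mulV, Matrix.mulVec_sub]

end MulV

namespace Problem

variable {N P I : ℕ} (pb : Problem N P I)

lemma cost_sub (x y : Vec N) : pb.cost (x - y) = pb.cost x - pb.cost y := inner_sub_right _ _ _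

-- By convexity of `g`, the value of `-g` at the new point is a convex combination in the interior
-- of the cone plus an element of the cone, and such a sum stays interior.
open scoped Pointwise in
lemma add_smul_sub_mem_dom {x y : Vec N} (hx : x ∈ pb.dom) (hy : ∀ i, y ∈ pb.ineqSet i) {s : ℝ}
    (hs : 0 ≤ s) (hs1 : s < 1) : x + s • (y - x) ∈ pb.dom := by
  intro i
  have hz : x + s • (y - x) = s • y + (1 - s) • x := by module
  have hconv : Convex ℝ (pb.K i : Set (Vec (pb.q i))) := (pb.K i).convex
  have h1 := hconv.combo_interior_self_mem_interior (hx i) (hy i) (sub_pos.2 hs1) hs (by ring)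
  have h2 := pb.g_convex i y x s hs hs1.le
  have hsub : interior (pb.K i : Set (Vec (pb.q i))) + (pb.K i : Set (Vec (pb.q i)))
      ⊆ interior (pb.K i : Set (Vec (pb.q i))) := by
    refine interior_maximal ?_ isOpen_interior.add_right
    rintro _ ⟨a, ha, b, hb, rfl⟩
    exact (pb.K i).add_mem (interior_subset ha) hb
  have h3 := hsub (Set.add_mem_add h1 h2)
  rw [hz]
  convert h3 using 1
  module

lemma mem_ineqSet_of_mem_dom {x : Vec N} (hx : x ∈ pb.dom) (i : Fin I) : x ∈ pb.ineqSet i :=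
  show -(pb.g i x) ∈ (pb.K i : Set (Vec (pb.q i))) from interior_subset (hx i)

lemma mem_feasible_of_mem_dom {x : Vec N} {t : ℕ} (hx : x ∈ pb.dom)
    (hA : mulV pb.A x = pb.b t) : x ∈ pb.feasible t :=
  ⟨pb.mem_ineqSet_of_mem_dom hx, hA⟩

section Newton

variable {pb} (hf : IsSelfConcordantOn pb.barrier pb.dom)

include hf

lemma gradient_penalized_dotProduct {x : Vec N} (hx : x ∈ pb.dom) (η : ℝ) (v : Vec N) :
    (gradient (pb.penalized η) x).ofLp ⬝ᵥ v.ofLp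
      = η * pb.cost v + fderiv ℝ pb.barrier x v := by
  rw [gradient_dotProduct]
  have h1 : HasFDerivAt (fun x => η * pb.cost x) (η • innerSL ℝ pb.c) x :=
    ((innerSL ℝ pb.c).hasFDerivAt (x := x)).const_mul η
  have h2 := h1.add (hf.differentiableAt hx).hasFDerivAt
  have h3 : fderiv ℝ (pb.penalized η) x = η • innerSL ℝ pb.c + fderiv ℝ pb.barrier x := h2.fderiv
  rw [h3]
  simp [cost]

lemma isUnit_kkt {x : Vec N} (hx : x ∈ pb.dom) : IsUnit (pb.kkt x) := by
  rw [← Matrix.mulVec_injective_iff_isUnit, ← Matrix.coe_mulVecLin,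
    ← LinearMap.ker_eq_bot, LinearMap.ker_eq_bot']
  intro z hz
  have hz' : pb.kkt x *ᵥ z = 0 := hz
  rw [kkt, Matrix.fromBlocks_mulVec] at hz'
  have h1 : hessian pb.barrier x *ᵥ (z ∘ Sum.inl) + pb.Aᵀ *ᵥ (z ∘ Sum.inr) = 0 := by
    ext i; simpa using congrFun hz' (Sum.inl i)
  have h2 : pb.A *ᵥ (z ∘ Sum.inl) = 0 := by
    ext i; simpa using congrFun hz' (Sum.inr i)
  -- Pairing the first block with the primal part u kills the `Aᵀ` term since A u = 0, leaving uᵀHu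
  -- = 0.
  have hu : z ∘ Sum.inl = 0 := by
    by_contra hne
    have hpos := (hf.posDef x hx).dotProduct_mulVec_pos hne
    have h3 := congrArg (fun r => (z ∘ Sum.inl) ⬝ᵥ r) h1
    simp only [dotProduct_add, dotProduct_zero] at h3
    rw [Matrix.dotProduct_mulVec _ pb.Aᵀ, Matrix.vecMul_transpose, h2, zero_dotProduct,
      add_zero] at h3
    simp only [star_trivial] at hpos
    linarith
  rw [hu, Matrix.mulVec_zero, zero_add] at h1
  have hinj : Function.Injective pb.Aᵀ.mulVec := by
    rw [Matrix.mulVec_injective_iff, linearIndependent_iff_card_eq_finrank_span]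
    have := pb.A_rank
    rw [← Matrix.rank_transpose, Matrix.rank_eq_finrank_span_cols] at this
    rw [Set.finrank, this, Fintype.card_fin]
  have hw : z ∘ Sum.inr = 0 := hinj (by rw [h1, Matrix.mulVec_zero])
  ext (i | i)
  · exact congrFun hu i
  · exact congrFun hw i

lemma kkt_inv_mulVec_spec {x : Vec N} (hx : x ∈ pb.dom) (R : Fin N ⊕ Fin P → ℝ) :
    hessian pb.barrier x *ᵥ (((pb.kkt x)⁻¹ *ᵥ R) ∘ Sum.inl)
        + pb.Aᵀ *ᵥ (((pb.kkt x)⁻¹ *ᵥ R) ∘ Sum.inr) = R ∘ Sum.inl ∧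
      pb.A *ᵥ (((pb.kkt x)⁻¹ *ᵥ R) ∘ Sum.inl) = R ∘ Sum.inr := by
  have h : pb.kkt x *ᵥ ((pb.kkt x)⁻¹ *ᵥ R) = R := by
    rw [Matrix.mulVec_mulVec,
      Matrix.mul_nonsing_inv _ ((Matrix.isUnit_iff_isUnit_det _).1 (isUnit_kkt hf hx)),
      Matrix.one_mulVec]
  set z := (pb.kkt x)⁻¹ *ᵥ R
  rw [kkt, Matrix.fromBlocks_mulVec] at h
  constructor
  · ext i; simpa using congrFun h (Sum.inl i)
  · ext i; simpa using congrFun h (Sum.inr i)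

lemma kkt_inv_hessForm {x : Vec N} (hx : x ∈ pb.dom) (R : Fin N ⊕ Fin P → ℝ) (v : Vec N) :
    hessForm pb.barrier x v (WithLp.toLp 2 (((pb.kkt x)⁻¹ *ᵥ R) ∘ Sum.inl))
        + (mulV pb.A v).ofLp ⬝ᵥ (((pb.kkt x)⁻¹ *ᵥ R) ∘ Sum.inr)
      = v.ofLp ⬝ᵥ (R ∘ Sum.inl) := by
  rw [← (kkt_inv_mulVec_spec hf hx R).1, dotProduct_add, ← dotProduct_hessian_mulVec,
    Matrix.dotProduct_mulVec _ pb.Aᵀ, Matrix.vecMul_transpose]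
  rfl

end Newton

/-! ### Centering and the effect of single Newton steps. -/

/-- `x` is `lam`-centered for the parameter `η`: the derivative of `d_η` along the kernel of `A`
has dual local norm at most `lam`. -/
def Centered (η lam : ℝ) (x : Vec N) : Prop :=
  ∀ v, mulV pb.A v = 0 →
    η * pb.cost v + fderiv ℝ pb.barrier x v ≤ lam * localNorm pb.barrier x v

/-- `h` is the primal part of a Newton step for `d_η` at `x`. -/
def IsNewtonStep (η : ℝ) (x h : Vec N) : Prop :=
  ∀ v, mulV pb.A v = 0 →
    η * pb.cost v + fderiv ℝ pb.barrier x v + hessForm pb.barrier x h v = 0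

/-- `δ` can be reached by a step of local length at most `√e` that is orthogonal to the kernel. -/
def HasShift (x : Vec N) (δ : Vec P) (e : ℝ) : Prop :=
  ∃ u, mulV pb.A u = δ ∧ (∀ v, mulV pb.A v = 0 → hessForm pb.barrier x u v = 0) ∧
    hessForm pb.barrier x u u ≤ e

lemma hasShift_zero (x : Vec N) {e : ℝ} (he : 0 ≤ e) : pb.HasShift x 0 e :=
  ⟨0, by ext; simp [mulV], by simp [hessForm], by simpa [hessForm] using he⟩

section Centering

variable {pb} (hf : IsSelfConcordantOn pb.barrier pb.dom)

include hf

/-- Tested on the kernel of `A`, both the old and the new multiplier vanish. With `r` and `ν` free,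
this serves the t-step and the η-step alike. -/
lemma exists_isNewtonStep {x : Vec N} (hx : x ∈ pb.dom) (η : ℝ) (ν : Vec P)
    (y : Vec N × Vec P) (hy : y.1 = x) (r : Fin P → ℝ) :
    ∃ h, IsNewtonStep pb η x h ∧ mulV pb.A h = -WithLp.toLp 2 r ∧
      (move y (-((pb.kkt x)⁻¹ *ᵥ Sum.elim
        (fun j => gradient (pb.penalized η) x j + (pb.Aᵀ *ᵥ ν.ofLp) j) r))).1 = x + h := by
  set R : Fin N ⊕ Fin P → ℝ := Sum.elim
    (fun j => gradient (pb.penalized η) x j + (pb.Aᵀ *ᵥ ν.ofLp) j) r with hR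
  refine ⟨-WithLp.toLp 2 (((pb.kkt x)⁻¹ *ᵥ R) ∘ Sum.inl), ?_, ?_, ?_⟩
  · intro v hv
    have h1 := kkt_inv_hessForm hf hx R v
    have h2 : R ∘ Sum.inl
        = (gradient (pb.penalized η) x).ofLp + pb.Aᵀ *ᵥ ν.ofLp := by
      ext j; simp [hR]
    have h3 : v.ofLp ⬝ᵥ (pb.Aᵀ *ᵥ ν.ofLp) = (mulV pb.A v).ofLp ⬝ᵥ ν.ofLp := by
      rw [Matrix.dotProduct_mulVec, Matrix.vecMul_transpose]; rfl
    rw [h2, dotProduct_add, h3, hv, dotProduct_comm v.ofLp,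
      gradient_penalized_dotProduct hf hx] at h1
    simp only [WithLp.ofLp_zero, zero_dotProduct, add_zero] at h1
    rw [hf.hessForm_comm hx, ← neg_one_smul ℝ (WithLp.toLp 2 _), hessForm_smul_right, h1]
    ring
  · have h1 := (kkt_inv_mulVec_spec hf hx R).2
    have h2 : R ∘ Sum.inr = r := by ext j; simp [hR]
    rw [h2] at h1
    ext j
    have := congrFun h1 j
    simp only [mulV, WithLp.ofLp_neg, Matrix.mulVec_neg, PiLp.neg_apply, Pi.neg_apply]
    rw [this]
  · ext j
    simp [move, hy]

/-- Pythagoras: h = u - k with `k` in the kernel and `u` Hessian-orthogonal to it. The Newton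
equation tested on `k` equates ‖k‖² with the derivative of `d_η` along `k`, so ‖k‖ ≤ lam. -/
lemma IsNewtonStep.localNorm_sq_le {η lam e : ℝ} {x h : Vec N} (hh : pb.IsNewtonStep η x h)
    (hx : x ∈ pb.dom) (hc : pb.Centered η lam x) (hlam : 0 ≤ lam)
    (hs : pb.HasShift x (mulV pb.A h) e) :
    localNorm pb.barrier x h ^ 2 ≤ lam ^ 2 + e := by
  obtain ⟨u, hu, horth, hue⟩ := hs
  set k := u - h with hk
  have hk0 : mulV pb.A k = 0 := by rw [hk, mulV_sub, hu, sub_self]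
  have hkh : h = u + (-1 : ℝ) • k := by rw [hk]; module
  have h1 := hc k hk0
  have h2 := hh k hk0
  have h3 := horth k hk0
  have h3' : hessForm pb.barrier x k u = 0 := by rw [hf.hessForm_comm hx, h3]
  have hform : hessForm pb.barrier x h k = - localNorm pb.barrier x k ^ 2 := by
    rw [hkh, hessForm_add_left, hessForm_smul_left, h3, hf.localNorm_sq hx]; ring
  have hnorm : localNorm pb.barrier x h ^ 2
      = hessForm pb.barrier x u u + localNorm pb.barrier x k ^ 2 := by
    rw [hf.localNorm_sq hx, hf.localNorm_sq hx, hkh]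
    simp only [hessForm_add_left, hessForm_add_right, hessForm_smul_left, hessForm_smul_right,
      h3, h3']
    ring
  have hk1 : localNorm pb.barrier x k ≤ lam := by
    have h0 := localNorm_nonneg (f := pb.barrier) x k
    by_contra! hcon
    nlinarith
  have := pow_le_pow_left₀ (localNorm_nonneg (f := pb.barrier) x k) hk1 2
  linarith

lemma IsNewtonStep.centered_add {η ρ : ℝ} {x h : Vec N} (hh : pb.IsNewtonStep η x h)
    (hx : x ∈ pb.dom) (hρ : localNorm pb.barrier x h ^ 2 ≤ ρ) (hρ' : ρ ≤ 1 / 25) :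
    x + h ∈ pb.dom ∧ pb.Centered η (15 / 8 * ρ) (x + h) := by
  have h5 : localNorm pb.barrier x h ≤ 1 / 5 :=
    abs_le_of_sq_le_sq' (by norm_num; linarith) (by norm_num) |>.2
  refine ⟨hf.mem_of_localNorm_lt hx (by rw [add_sub_cancel_left]; linarith), fun v hv => ?_⟩
  refine (hf.fderiv_add_le_of_newton hx h5 (hh v hv)).trans ?_
  exact mul_le_mul_of_nonneg_right (by linarith) (localNorm_nonneg _ _)

/-- With (u, w) = D⁻¹(0, δ), the first block Hu + Aᵀw = 0 gives orthogonality to the kernel and uᵀHu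
= -δ·w ≤ ‖δ‖²/m. -/
lemma hasShift_of_norm_le {x : Vec N} (hx : x ∈ pb.dom) {m : ℝ} (hm : 0 < m)
    (hinv : ‖Matrix.toEuclideanCLM (n := Fin N ⊕ Fin P) (𝕜 := ℝ) (pb.kkt x)⁻¹‖ ≤ 1 / m)
    {δ : Vec P} (hδ : ‖δ‖ ≤ Real.sqrt (3 * m / 160)) : pb.HasShift x δ (3 / 160) := by
  set R : Fin N ⊕ Fin P → ℝ := Sum.elim 0 δ.ofLp with hR
  have hRl : R ∘ Sum.inl = 0 := by ext j; simp [hR]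
  have hRr : R ∘ Sum.inr = δ.ofLp := by ext j; simp [hR]
  set z := (pb.kkt x)⁻¹ *ᵥ R with hz
  set u : Vec N := WithLp.toLp 2 (z ∘ Sum.inl) with hu
  have hAu : mulV pb.A u = δ := by
    have := (kkt_inv_mulVec_spec hf hx R).2
    rw [hRr] at this
    ext j
    exact congrFun this j
  have hform := kkt_inv_hessForm hf hx R
  rw [hRl] at hform
  simp only [dotProduct_zero] at hform
  refine ⟨u, hAu, fun v hv => ?_, ?_⟩
  · have := hform v
    rw [hv] at this
    rw [hf.hessForm_comm hx]
    simpa using this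
  · have h1 := hform u
    rw [hAu] at h1
    set w : Vec P := WithLp.toLp 2 (z ∘ Sum.inr) with hw
    have h2 : |δ.ofLp ⬝ᵥ (z ∘ Sum.inr)| ≤ ‖w‖ * ‖δ‖ := by
      have := abs_real_inner_le_norm w δ
      rw [EuclideanSpace.inner_eq_star_dotProduct] at this
      simpa [hw] using this
    have h3 : ‖w‖ ≤ 1 / m * ‖δ‖ := by
      have hle : ‖w‖ ≤ ‖(WithLp.toLp 2 z : EuclideanSpace ℝ (Fin N ⊕ Fin P))‖ := by
        rw [EuclideanSpace.norm_eq, EuclideanSpace.norm_eq]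
        refine Real.sqrt_le_sqrt ?_
        rw [Fintype.sum_sum_type]
        exact le_add_of_nonneg_left (Finset.sum_nonneg fun _ _ => sq_nonneg _)
      have hRn : ‖(WithLp.toLp 2 R : EuclideanSpace ℝ (Fin N ⊕ Fin P))‖ = ‖δ‖ := by
        rw [EuclideanSpace.norm_eq, EuclideanSpace.norm_eq, Fintype.sum_sum_type]
        simp [hR]
      have hop := (Matrix.toEuclideanCLM (n := Fin N ⊕ Fin P) (𝕜 := ℝ) (pb.kkt x)⁻¹).le_opNorm
        (WithLp.toLp 2 R)
      rw [Matrix.toEuclideanCLM_toLp, ← hz, hRn] at hop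
      exact (hle.trans hop).trans (mul_le_mul_of_nonneg_right hinv (norm_nonneg _))
    have h4 : ‖δ‖ ^ 2 ≤ 3 * m / 160 := by
      have := pow_le_pow_left₀ (norm_nonneg δ) hδ 2
      rwa [Real.sq_sqrt (by positivity)] at this
    have h5 : ‖w‖ * ‖δ‖ ≤ 3 / 160 := calc
      ‖w‖ * ‖δ‖ ≤ 1 / m * ‖δ‖ * ‖δ‖ := mul_le_mul_of_nonneg_right h3 (norm_nonneg _)
      _ = ‖δ‖ ^ 2 / m := by ring
      _ ≤ 3 / 160 := by rw [div_le_iff₀ hm]; linarith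
    linarith [neg_abs_le (δ.ofLp ⬝ᵥ (z ∘ Sum.inr))]

lemma tStep_spec {x : Vec N} {ν : Vec P} {t : ℕ} {η : ℝ} (hx : x ∈ pb.dom)
    (hc : pb.Centered η (1 / 9) x)
    (hs : pb.HasShift x (pb.b t - mulV pb.A x) (3 / 160)) :
    (pb.tStep t η (x, ν)).1 ∈ pb.dom ∧ mulV pb.A (pb.tStep t η (x, ν)).1 = pb.b t ∧
      pb.Centered η (15 / 8 * (1 / 81 + 3 / 160)) (pb.tStep t η (x, ν)).1 := by
  obtain ⟨h, hn, hA, hmove⟩ := exists_isNewtonStep hf hx η ν (x, ν) rfl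
    (fun k => mulV pb.A x k - pb.b t k)
  have hstep : (pb.tStep t η (x, ν)).1 = x + h := hmove
  have hA' : mulV pb.A h = pb.b t - mulV pb.A x := by
    rw [hA]; ext k; simp
  have hsq := hn.localNorm_sq_le hf hx hc (by norm_num) (by rwa [hA'])
  norm_num only [one_div] at hsq
  obtain ⟨h1, h2⟩ := hn.centered_add hf hx hsq (by norm_num)
  rw [hstep]
  refine ⟨h1, by rw [mulV_add, hA']; abel, ?_⟩
  norm_num only [one_div] at h2 ⊢
  exact h2

/-- The zero second block makes the shift vanish, so ρ = 1/25 and 15/8 · 1/25 = 3/40 ≤ 1/9. -/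
lemma etaStep_spec {y : Vec N × Vec P} {ν : Vec P} {η : ℝ} (hx : y.1 ∈ pb.dom)
    (hc : pb.Centered η (1 / 5) y.1) :
    (pb.etaStep η ν y).1 ∈ pb.dom ∧ mulV pb.A (pb.etaStep η ν y).1 = mulV pb.A y.1 ∧
      pb.Centered η (1 / 9) (pb.etaStep η ν y).1 := by
  obtain ⟨h, hn, hA, hmove⟩ := exists_isNewtonStep hf hx η ν y rfl 0
  have hstep : (pb.etaStep η ν y).1 = y.1 + h := hmove
  have hA' : mulV pb.A h = 0 := by rw [hA]; simp
  have hsq := hn.localNorm_sq_le hf hx hc (by norm_num)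
    (by rw [hA']; exact pb.hasShift_zero y.1 le_rfl)
  obtain ⟨h1, h2⟩ := hn.centered_add hf hx hsq (by norm_num)
  rw [hstep]
  refine ⟨h1, by rw [mulV_add, hA', add_zero], fun v hv => (h2 v hv).trans ?_⟩
  exact mul_le_mul_of_nonneg_right (by norm_num) (localNorm_nonneg _ _)

/-- At a point with A x = b_t the primal step lies in the kernel of `A`, so the cross terms of the
indefinite KKT form vanish and `matNorm` is a true local norm; Cauchy–Schwarz finishes. -/
lemma centered_of_matNorm_newton_le {x : Vec N} {ν : Vec P} {t : ℕ} {η lam : ℝ}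
    (hx : x ∈ pb.dom) (hA : mulV pb.A x = pb.b t)
    (hn : matNorm (pb.kkt x) (pb.newton t η (x, ν)) ≤ lam) : pb.Centered η lam x := by
  obtain ⟨h, hh, hAh, hmove⟩ := exists_isNewtonStep hf hx η ν (x, ν) rfl
    (fun k => mulV pb.A x k - pb.b t k)
  have hAh0 : mulV pb.A h = 0 := by rw [hAh, hA]; ext k; simp
  have hinl : pb.newton t η (x, ν) ∘ Sum.inl = h.ofLp := by
    have hmove' : (move (x, ν) (pb.newton t η (x, ν))).1 = x + h := hmove
    ext j
    simpa [move] using congrArg (fun v : Vec N => v j) hmove'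
  have hAh0' : pb.A *ᵥ h.ofLp = 0 := congrArg WithLp.ofLp hAh0
  have hnorm : matNorm (pb.kkt x) (pb.newton t η (x, ν)) = localNorm pb.barrier x h := by
    rw [matNorm, localNorm, kkt, Matrix.fromBlocks_mulVec, hinl, hAh0']
    congr 1
    rw [← dotProduct_hessian_mulVec]
    conv_lhs => rw [← Sum.elim_comp_inl_inr (pb.newton t η (x, ν)), hinl]
    rw [sumElim_dotProduct_sumElim, dotProduct_add, Matrix.dotProduct_mulVec _ pb.Aᵀ,
      Matrix.vecMul_transpose, hAh0']
    simp
  rw [hnorm] at hn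
  intro v hv
  have h1 := hh v hv
  have h2 := hf.hessForm_le_mul hx h (-v)
  rw [localNorm_neg, ← neg_one_smul ℝ v, hessForm_smul_right] at h2
  have := mul_le_mul_of_nonneg_right hn (localNorm_nonneg (f := pb.barrier) x v)
  linarith

-- The derivative of `d_{βη}` is β times that of `d_η` minus (β - 1) times that of the barrier.
omit hf in
lemma Centered.mul_eta {η lam β vf : ℝ} {x : Vec N} (hc : pb.Centered η lam x)
    (hβ : 1 ≤ β)
    (hL : ∀ v, fderiv ℝ pb.barrier x v ≤ Real.sqrt vf * localNorm pb.barrier x v) :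
    pb.Centered (η * β) (β * lam + (β - 1) * Real.sqrt vf) x := by
  intro v hv
  have h1 := mul_le_mul_of_nonneg_left (hc v hv) (zero_le_one.trans hβ)
  have h2 := mul_le_mul_of_nonneg_left (hL (-v)) (sub_nonneg.2 hβ)
  rw [localNorm_neg, map_neg] at h2
  linarith

omit hf in
lemma Centered.mono {η lam lam' : ℝ} {x : Vec N} (hc : pb.Centered η lam x) (h : lam ≤ lam') :
    pb.Centered η lam' x := fun v hv =>
  (hc v hv).trans (mul_le_mul_of_nonneg_right h (localNorm_nonneg _ _))

end Centering

end Problem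

end OIPM

/-! ### Suboptimality, compactness of the optimal sets and summation. -/

namespace OIPM

lemma IsSelfConcordantOn.exists_mul_norm_le {n : ℕ} {f : Vec n → ℝ} {S : Set (Vec n)}
    (hf : IsSelfConcordantOn f S) {x : Vec n} (hx : x ∈ S) :
    ∃ κ > 0, ∀ v, κ * ‖v‖ ≤ localNorm f x v := by
  rcases (Metric.sphere (0 : Vec n) 1).eq_empty_or_nonempty with he | hne
  · refine ⟨1, one_pos, fun v => ?_⟩
    rcases eq_or_ne v 0 with rfl | hv
    · simp [localNorm_zero]
    · have : ‖v‖⁻¹ • v ∈ Metric.sphere (0 : Vec n) 1 := by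
        simp [norm_smul, inv_mul_cancel₀ (norm_ne_zero_iff.2 hv)]
      simp [he] at this
  · obtain ⟨u, hu, hmin⟩ := (isCompact_sphere (0 : Vec n) 1).exists_isMinOn hne
      (continuous_localNorm (f := f) x).continuousOn
    have hu0 : u ≠ 0 := by rintro rfl; simp at hu
    refine ⟨localNorm f x u, hf.localNorm_pos hx hu0, fun v => ?_⟩
    rcases eq_or_ne v 0 with rfl | hv
    · simp [localNorm_zero]
    · have hv' : 0 < ‖v‖ := norm_pos_iff.2 hv
      have h1 : ‖v‖⁻¹ • v ∈ Metric.sphere (0 : Vec n) 1 := by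
        simp [norm_smul, inv_mul_cancel₀ hv'.ne']
      have h2 : localNorm f x u ≤ localNorm f x (‖v‖⁻¹ • v) := hmin h1
      rw [localNorm_smul, abs_of_pos (inv_pos.2 hv'), ← div_eq_inv_mul, le_div_iff₀ hv'] at h2
      exact h2

namespace Problem

variable {N P I : ℕ} {pb : Problem N P I} {vf : ℝ}

lemma BarrierComplexity.fderiv_le (hb : pb.BarrierComplexity vf) :
    ∀ x ∈ pb.dom, ∀ v, fderiv ℝ pb.barrier x v ≤ Real.sqrt vf * localNorm pb.barrier x v :=
  fun x hx v => hb.selfConcordant.fderiv_le_sqrt_mul hx (hb.complexity_le x hx) v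

lemma BarrierComplexity.le_sqrt (hb : pb.BarrierComplexity vf) (hne : pb.dom.Nonempty) :
    9 / 20 ≤ Real.sqrt vf :=
  hb.selfConcordant.le_of_fderiv_le hne (Nat.zero_le P |>.trans_lt pb.P_lt_N) hb.fderiv_le

lemma BarrierComplexity.gap_le (hb : pb.BarrierComplexity vf) (hvf : 0 < vf) {x y : Vec N} {t : ℕ}
    {η : ℝ} (hx : x ∈ pb.dom) (hA : mulV pb.A x = pb.b t) (hc : pb.Centered η (1 / 9) x)
    (hy : y ∈ pb.feasible t) :
    η * (pb.cost x - pb.cost y) ≤ 11 / 5 * vf - 1 / 720 * localNorm pb.barrier x (y - x) := by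
  have hseg : ∀ s : ℝ, 0 ≤ s → s < 1 → x + s • (y - x) ∈ pb.dom := fun s hs hs1 =>
    pb.add_smul_sub_mem_dom hx hy.1 hs hs1
  have hf := hb.selfConcordant
  have h1 := hc (x - y) (by rw [mulV_sub, hA, hy.2, sub_self])
  rw [cost_sub, ← neg_sub y x, localNorm_neg, map_neg] at h1
  have hsq := pow_le_pow_left₀ (by norm_num) (hb.le_sqrt ⟨x, hx⟩) 2
  rw [Real.sq_sqrt hvf.le] at hsq
  -- For r ≥ 1 the slope is 1/9 - 9/80 = -1/720. For r ≤ 1 the needed 9/80·r ≤ 6/5·vf follows from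
  -- vf ≥ 81/400.
  rcases le_total 1 (localNorm pb.barrier x (y - x)) with hr | hr
  · have h2 := hf.fderiv_segment_le_of_one_le hvf hb.fderiv_le hseg hr
    linarith
  · have h2 := hf.fderiv_segment_le hvf hb.fderiv_le hseg
    linarith

/-- The term -r/720 in `gap_le` bounds the sublevel set through `x`; the radius comes from 720 ·
11/5 = 1584. -/
lemma BarrierComplexity.optimal_nonempty_isBounded (hb : pb.BarrierComplexity vf) (hvf : 0 < vf)
    {x : Vec N} {t : ℕ} {η : ℝ} (hη : 0 < η) (hx : x ∈ pb.dom) (hA : mulV pb.A x = pb.b t)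
    (hc : pb.Centered η (1 / 9) x) (hcl : IsClosed (pb.feasible t)) :
    (pb.optimal t).Nonempty ∧ Bornology.IsBounded (pb.optimal t) := by
  have hxf := pb.mem_feasible_of_mem_dom hx hA
  have hcost : Continuous pb.cost := by unfold cost; fun_prop
  set Q := pb.feasible t ∩ {y | pb.cost y ≤ pb.cost x} with hQ
  have hQcl : IsClosed Q := hcl.inter (isClosed_le hcost continuous_const)
  have hQb : Bornology.IsBounded Q := by
    obtain ⟨κ, hκ, hle⟩ := hb.selfConcordant.exists_mul_norm_le hx
    refine Metric.isBounded_closedBall (x := x) (r := (1584 * vf) / κ) |>.subset ?_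
    rintro y ⟨hy, hyx⟩
    have h1 := hb.gap_le hvf hx hA hc hy
    have h2 : 0 ≤ η * (pb.cost x - pb.cost y) := mul_nonneg hη.le (sub_nonneg.2 hyx)
    rw [Metric.mem_closedBall, dist_eq_norm, le_div_iff₀ hκ]
    linarith [hle (y - x)]
  have hsub : pb.optimal t ⊆ Q := fun y hy => ⟨hy.1, hy.2 x hxf⟩
  refine ⟨?_, hQb.subset hsub⟩
  obtain ⟨z, hz, hmin⟩ := (Metric.isCompact_of_isClosed_isBounded hQcl hQb).exists_isMinOn
    ⟨x, hxf, le_refl (pb.cost x)⟩ hcost.continuousOn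
  refine ⟨z, hz.1, fun y hy => ?_⟩
  rcases le_total (pb.cost y) (pb.cost x) with h | h
  · exact hmin ⟨hy, h⟩
  · exact hz.2.trans h

/-- Optimal values differ by at most the Hausdorff distance of the optimal sets, scaled by `‖c‖`. -/
lemma cost_sub_le_hausdorffDist {x y : Vec N} {s t : ℕ} (hx : x ∈ pb.optimal t)
    (hy : y ∈ pb.optimal s) (ht : Bornology.IsBounded (pb.optimal t))
    (hs : Bornology.IsBounded (pb.optimal s)) :
    pb.cost y - pb.cost x ≤ ‖pb.c‖ * Metric.hausdorffDist (pb.optimal t) (pb.optimal s) := by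
  have h1 := Metric.infDist_le_hausdorffDist_of_mem hx
    (Metric.hausdorffEDist_ne_top_of_nonempty_of_bounded ⟨x, hx⟩ ⟨y, hy⟩ ht hs)
  have hle : ∀ z ∈ pb.optimal s, pb.cost y - pb.cost x ≤ ‖pb.c‖ * dist x z := by
    intro z hz
    have h2 : pb.cost y - pb.cost x ≤ pb.cost (z - x) := by
      rw [cost_sub]
      linarith [hy.2 z hz.1]
    rw [dist_comm, dist_eq_norm]
    exact h2.trans (real_inner_le_norm _ _)
  refine le_trans ?_ (mul_le_mul_of_nonneg_left h1 (norm_nonneg _))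
  -- Dividing by ‖c‖ to pass to the infimum requires c ≠ 0.
  rcases (norm_nonneg pb.c).eq_or_lt with h0 | h0
  · have := hle y hy
    rw [← h0, zero_mul] at this ⊢
    exact this
  · rw [← div_le_iff₀' h0, Metric.le_infDist ⟨y, hy⟩]
    intro z hz
    rw [div_le_iff₀' h0]
    exact hle z hz

lemma eta_pos {η₀ β : ℝ} (hη₀ : 0 < η₀) (hβ : 0 < β) (t : ℕ) : 0 < eta η₀ β t := by
  induction t with
  | zero => exact hη₀
  | succ t ih => exact mul_pos ih hβ

lemma sum_inv_eta {η₀ β : ℝ} (hη₀ : 0 < η₀) (hβ : 1 < β) (T : ℕ) :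
    ∑ t ∈ Finset.Icc 1 T, (eta η₀ β t)⁻¹ + ((β - 1) * eta η₀ β T)⁻¹ = ((β - 1) * η₀)⁻¹ := by
  induction T with
  | zero => simp [eta]
  | succ T ih =>
    rw [Finset.sum_Icc_succ_top (by omega), ← ih]
    have h1 := (eta_pos hη₀ (zero_lt_one.trans hβ) T).ne'
    have h2 := (sub_pos.2 hβ).ne'
    have h3 := (zero_lt_one.trans hβ).ne'
    simp only [eta]
    field_simp
    ring

/-! ### The invariant along the run. -/

section Run

variable {m β η₀ : ℝ} {x₀ : Vec N} {ν₀ : Vec P}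

lemma mid_spec (hb : pb.BarrierComplexity vf) (hm : 0 < m) {T t : ℕ} (hreg : pb.RegularUpTo m T)
    (ht : t ≤ T) {y₀ : Vec N × Vec P} (hx : (pb.iter η₀ β y₀ t).1 ∈ pb.dom)
    (hA : mulV pb.A (pb.iter η₀ β y₀ t).1 = pb.b (t - 1))
    (hc : pb.Centered (eta η₀ β t) (1 / 9) (pb.iter η₀ β y₀ t).1) :
    (pb.mid η₀ β y₀ t).1 ∈ pb.dom ∧ mulV pb.A (pb.mid η₀ β y₀ t).1 = pb.b t ∧
      pb.Centered (eta η₀ β t) (15 / 8 * (1 / 81 + 3 / 160)) (pb.mid η₀ β y₀ t).1 := by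
  refine tStep_spec hb.selfConcordant hx hc ?_
  rw [hA]
  rcases Nat.eq_zero_or_pos t with rfl | hpos
  -- In round 0 the truncated index t - 1 is again 0, so no shift is needed.
  · rw [Nat.zero_sub, sub_self]
    exact pb.hasShift_zero _ (by norm_num)
  · exact hasShift_of_norm_le hb.selfConcordant hx hm
      (hreg.kkt_inv_le (t - 1) (by omega) _ (pb.mem_feasible_of_mem_dom hx hA) hx)
      (hreg.step_le t hpos ht)

lemma iter_spec (hb : pb.BarrierComplexity vf) (hvf : 0 < vf) (hm : 0 < m) (hβ : 1 < β)
    (hβ' : β ≤ 1 + 1 / (8 * Real.sqrt vf)) {y₀ : Vec N × Vec P} (hx₀ : y₀.1 ∈ pb.dom)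
    (hAx₀ : mulV pb.A y₀.1 = pb.b 0) (hc₀ : pb.Centered η₀ (1 / 9) y₀.1) {T : ℕ}
    (hreg : pb.RegularUpTo m T) (t : ℕ) (ht : t ≤ T) :
    (pb.iter η₀ β y₀ t).1 ∈ pb.dom ∧ mulV pb.A (pb.iter η₀ β y₀ t).1 = pb.b (t - 1) ∧
      pb.Centered (eta η₀ β t) (1 / 9) (pb.iter η₀ β y₀ t).1 := by
  induction t with
  | zero => exact ⟨hx₀, hAx₀, hc₀⟩
  | succ t ih =>
    obtain ⟨h1, h2, h3⟩ := ih (by omega)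
    obtain ⟨k1, k2, k3⟩ := mid_spec hb hm hreg (by omega) h1 h2 h3
    have hc := (k3.mul_eta hβ.le (hb.fderiv_le _ k1)).mono (lam' := 1 / 5) (by
      have hs := hb.le_sqrt ⟨_, hx₀⟩
      have hspos : 0 < Real.sqrt vf := Real.sqrt_pos.2 hvf
      have e1 : (β - 1) * Real.sqrt vf ≤ 1 / 8 := by
        have e : β - 1 ≤ 1 / (8 * Real.sqrt vf) := by linarith
        rw [le_div_iff₀ (by positivity)] at e
        linarith
      -- From √vf ≥ 9/20; then β · 15/8 · (1/81 + 3/160) + 1/8 stays just below 1/5.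
      have e2 : β - 1 ≤ 5 / 18 := by nlinarith
      linarith)
    obtain ⟨l1, l2, l3⟩ := etaStep_spec hb.selfConcordant (ν := (pb.iter η₀ β y₀ t).2) k1 hc
    exact ⟨l1, l2.trans k2, l3⟩

/-- The stepwise bounds on the loss of the run, from above and from below. -/
lemma cost_iter_sub_bounds (hb : pb.BarrierComplexity vf) (hvf : 0 < vf) {t : ℕ} {η : ℝ}
    (hη : 0 < η) {x xs : Vec N} (hx : x ∈ pb.dom) (hA : mulV pb.A x = pb.b (t - 1))
    (hc : pb.Centered η (1 / 9) x) (hxs : xs ∈ pb.optimal t)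
    (ht : Bornology.IsBounded (pb.optimal t)) (hne : (pb.optimal (t - 1)).Nonempty)
    (hs : Bornology.IsBounded (pb.optimal (t - 1))) :
    pb.cost x - pb.cost xs ≤ 11 / 5 * vf * η⁻¹
        + ‖pb.c‖ * Metric.hausdorffDist (pb.optimal t) (pb.optimal (t - 1)) ∧
      -(‖pb.c‖ * Metric.hausdorffDist (pb.optimal t) (pb.optimal (t - 1)))
        ≤ pb.cost x - pb.cost xs := by
  obtain ⟨z, hz⟩ := hne
  have h1 := cost_sub_le_hausdorffDist hxs hz ht hs
  have h2 := cost_sub_le_hausdorffDist hz hxs hs ht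
  rw [Metric.hausdorffDist_comm] at h2
  have h3 := hz.2 x (pb.mem_feasible_of_mem_dom hx hA)
  have h4 : pb.cost x - pb.cost z ≤ 11 / 5 * vf * η⁻¹ := by
    rw [← div_eq_mul_inv, le_div_iff₀' hη]
    have hgap := hb.gap_le hvf hx hA hc hz.1
    linarith [localNorm_nonneg (f := pb.barrier) x (z - x)]
  constructor <;> linarith

end Run

end Problem

end OIPM

/-! ### Assembly of the bounds. -/

theorem theorem1 {N P I : ℕ} (pb : OIPM.Problem N P I) (vf m β η₀ : ℝ)
    (x₀ : OIPM.Vec N) (ν₀ : OIPM.Vec P)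
    (hvf : 0 < vf) (hm : 0 < m) (hη₀ : 0 < η₀)
    (hβ : 1 < β) (hβ' : β ≤ 1 + 1 / (8 * Real.sqrt vf))
    (hbarrier : pb.BarrierComplexity vf)
    (hx₀ : x₀ ∈ pb.dom) (hAx₀ : OIPM.mulV pb.A x₀ = pb.b 0)
    (hinit : OIPM.matNorm (pb.kkt x₀) (pb.newton 0 η₀ (x₀, ν₀)) ≤ 1 / 9) :
    (∀ T : ℕ, pb.RegularUpTo m T →
      -- the run is well defined, and the sets of optimal decisions are nonempty and bounded
      (∀ t ≤ T,
        ((pb.iter η₀ β (x₀, ν₀) t).1 ∈ pb.dom ∧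
          IsUnit (pb.kkt (pb.iter η₀ β (x₀, ν₀) t).1)) ∧
        ((pb.mid η₀ β (x₀, ν₀) t).1 ∈ pb.dom ∧
          IsUnit (pb.kkt (pb.mid η₀ β (x₀, ν₀) t).1)) ∧
        (pb.optimal t).Nonempty ∧ Bornology.IsBounded (pb.optimal t)) ∧
      -- the regret bound
      (∀ xs : ℕ → OIPM.Vec N, (∀ t, 1 ≤ t → t ≤ T → xs t ∈ pb.optimal t) →
        pb.regret (fun t => (pb.iter η₀ β (x₀, ν₀) t).1) xs T
          ≤ 11 * vf * β / (5 * η₀ * (β - 1)) + ‖pb.c‖ * pb.optVariation T) ∧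
      -- the constraint violation bound
      pb.violation (fun t => (pb.iter η₀ β (x₀, ν₀) t).1) T ≤ pb.rhsVariation T) ∧
    -- the orders of growth, when the assumptions hold in all rounds
    ((∀ T : ℕ, pb.RegularUpTo m T) →
      (∀ xs : ℕ → OIPM.Vec N, (∀ t, 1 ≤ t → xs t ∈ pb.optimal t) →
        (fun T : ℕ => pb.regret (fun t => (pb.iter η₀ β (x₀, ν₀) t).1) xs T)
          =O[atTop] (fun T : ℕ => pb.optVariation T + 1)) ∧
      (fun T : ℕ => pb.violation (fun t => (pb.iter η₀ β (x₀, ν₀) t).1) T)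
        =O[atTop] (fun T : ℕ => pb.rhsVariation T)) := by
  have hf := hbarrier.selfConcordant
  have hc₀ := OIPM.Problem.centered_of_matNorm_newton_le hf hx₀ hAx₀ hinit
  have hiter := fun {T : ℕ} (hreg : pb.RegularUpTo m T) (t : ℕ) (ht : t ≤ T) =>
    OIPM.Problem.iter_spec (η₀ := η₀) hbarrier hvf hm hβ hβ' (y₀ := (x₀, ν₀)) hx₀ hAx₀ hc₀ hreg t ht
  have hη : ∀ t, 0 < OIPM.Problem.eta η₀ β t :=
    OIPM.Problem.eta_pos hη₀ (zero_lt_one.trans hβ)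
  have hmid := fun {T : ℕ} (hreg : pb.RegularUpTo m T) (t : ℕ) (ht : t ≤ T) =>
    OIPM.Problem.mid_spec hbarrier hm hreg ht (hiter hreg t ht).1 (hiter hreg t ht).2.1
      (hiter hreg t ht).2.2
  -- The intermediate iterate is the centered point of `D_t`; `x_t` itself is only known to satisfy
  -- the equality constraint of the preceding round.
  have hopt : ∀ {T : ℕ}, pb.RegularUpTo m T → ∀ t ≤ T,
      (pb.optimal t).Nonempty ∧ Bornology.IsBounded (pb.optimal t) := fun hreg t ht =>
    hbarrier.optimal_nonempty_isBounded hvf (hη t) (hmid hreg t ht).1 (hmid hreg t ht).2.1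
      ((hmid hreg t ht).2.2.mono (by norm_num)) (hreg.closed t ht)
  have hloss : ∀ {T : ℕ}, pb.RegularUpTo m T → ∀ xs : ℕ → OIPM.Vec N,
      (∀ t, 1 ≤ t → t ≤ T → xs t ∈ pb.optimal t) →
      pb.regret (fun t => (pb.iter η₀ β (x₀, ν₀) t).1) xs T
          ≤ 11 * vf * β / (5 * η₀ * (β - 1)) + ‖pb.c‖ * pb.optVariation T ∧
        -(‖pb.c‖ * pb.optVariation T)
          ≤ pb.regret (fun t => (pb.iter η₀ β (x₀, ν₀) t).1) xs T := by
    intro T hreg xs hxs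
    have hstep := fun t (ht : t ∈ Finset.Icc 1 T) =>
      have ht' := Finset.mem_Icc.1 ht
      have hpred : t - 1 ≤ T := (Nat.sub_le t 1).trans ht'.2
      OIPM.Problem.cost_iter_sub_bounds hbarrier hvf (hη t) (hiter hreg t ht'.2).1
        (hiter hreg t ht'.2).2.1 (hiter hreg t ht'.2).2.2 (hxs t ht'.1 ht'.2)
        (hopt hreg t ht'.2).2 (hopt hreg (t - 1) hpred).1 (hopt hreg (t - 1) hpred).2
    unfold OIPM.Problem.regret OIPM.Problem.optVariation
    constructor
    · refine (Finset.sum_le_sum fun t ht => (hstep t ht).1).trans ?_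
      rw [Finset.sum_add_distrib, ← Finset.mul_sum, ← Finset.mul_sum]
      refine add_le_add_left ?_ _
      have hβ1 := sub_pos.2 hβ
      have hsum := OIPM.Problem.sum_inv_eta hη₀ hβ T
      have hrest := inv_pos.2 (mul_pos hβ1 (hη T))
      calc 11 / 5 * vf * ∑ t ∈ Finset.Icc 1 T, (OIPM.Problem.eta η₀ β t)⁻¹
          ≤ 11 / 5 * vf * ((β - 1) * η₀)⁻¹ := by gcongr; linarith
        _ = 11 * vf * 1 / (5 * η₀ * (β - 1)) := by field_simp
        -- The sum starts at η₁ = β·η₀, so the factor `β` in the stated bound is slack.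
        _ ≤ 11 * vf * β / (5 * η₀ * (β - 1)) := by gcongr
    · rw [Finset.mul_sum, ← Finset.sum_neg_distrib]
      exact Finset.sum_le_sum fun t ht => (hstep t ht).2
  have hvio : ∀ {T : ℕ}, pb.RegularUpTo m T →
      pb.violation (fun t => (pb.iter η₀ β (x₀, ν₀) t).1) T ≤ pb.rhsVariation T := by
    intro T hreg
    refine Finset.sum_le_sum fun t ht => ?_
    obtain ⟨h1, h2, -⟩ := hiter hreg t (Finset.mem_Icc.1 ht).2
    rw [Finset.sum_eq_zero fun i _ =>
      Metric.infDist_zero_of_mem (pb.mem_ineqSet_of_mem_dom h1 i), zero_add, h2, norm_sub_rev]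
  refine ⟨fun T hreg => ⟨fun t ht => ⟨⟨(hiter hreg t ht).1,
    OIPM.Problem.isUnit_kkt hf (hiter hreg t ht).1⟩, ⟨(hmid hreg t ht).1,
    OIPM.Problem.isUnit_kkt hf (hmid hreg t ht).1⟩, hopt hreg t ht⟩,
    fun xs hxs => (hloss hreg xs hxs).1, hvio hreg⟩, fun hreg => ⟨fun xs hxs => ?_, ?_⟩⟩
  · set C := 11 * vf * β / (5 * η₀ * (β - 1))
    have hC : 0 ≤ C :=
      div_nonneg (by positivity) (mul_nonneg (by positivity) (sub_pos.2 hβ).le)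
    refine IsBigO.of_bound (C + ‖pb.c‖) (Eventually.of_forall fun T => ?_)
    -- The regret may be negative, as `x_t` can be infeasible for round t; its absolute value needs
    -- the lower bound too.
    obtain ⟨h1, h2⟩ := hloss (hreg T) xs fun t ht _ => hxs t ht
    have hV : 0 ≤ pb.optVariation T := Finset.sum_nonneg fun _ _ => Metric.hausdorffDist_nonneg
    rw [Real.norm_eq_abs, Real.norm_of_nonneg (by linarith), abs_le]
    have hCV := mul_nonneg hC hV
    have hc := norm_nonneg pb.c
    constructor <;> linarith
  · refine IsBigO.of_bound 1 (Eventually.of_forall fun T => ?_)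
    have h0 : 0 ≤ pb.violation (fun t => (pb.iter η₀ β (x₀, ν₀) t).1) T :=
      Finset.sum_nonneg fun _ _ => add_nonneg
        (Finset.sum_nonneg fun _ _ => Metric.infDist_nonneg) (norm_nonneg _)
    rw [Real.norm_of_nonneg h0, one_mul]
    exact (hvio (hreg T)).trans (le_abs_self _)
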